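/- Let $\mathbb K$ be a field of characteristic $0$ and let $A$ be an associative unital $\mathbb K$-algebra, with enveloping algebra $A^e = A\otimes_{\mathbb K} A^{op}$. View $A$ as a left $A^e$-module via $(a\otimes b)\cdot x = axb$, and view each group $\mathrm{Ext}^l_{A^e}(A,A^e)$ (extensions of left $A^e$-modules) as an $A$-bimodule through the right $A^e$-module structure of $A^e$, i.e. $a\cdot\xi\cdot b = \xi\,(b\otimes a)$. For an algebra endomorphism $\nu$ of $A$, let $A^\nu$ be the $A$-bimodule with underlying vector space $A$ and actions $a\cdot m\cdot b = a\,m\,\nu(b)$. Use the same notation for other algebras. Let $\omega\in A$ be a normal regular element, i.e. $\omega$ is neither a left nor a right zero-divisor and $A\omega=\omega A$, and let $B = A/\omega A$. Let $d\ge 0$ be an integer, and suppose that there is an algebra endomorphism $\nu: A\to A$ such that, as $A$-bimodules, $$\mathrm{Ext}^l_{A^e}(A,A^e)\cong\begin{cases}0, & l\neq d+1,\\ A^{\nu}, & l=d+1,\end{cases}\qquad l\geq 0.$$ Then there exists an algebra endomorphism $\kappa: B\to B$ such that, as $B$-bimodules, $$\mathrm{Ext}^l_{B^e}(B,B^e)\cong\begin{cases}0,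 & l\neq d,\\ B^{\kappa}, & l=d,\end{cases}\qquad l\geq 0.$$ -/

import Mathlib

open CategoryTheory TensorProduct MulOpposite

universe u v

noncomputable section

/-- An element `ω` of a ring `A` is normal if `A ω = ω A`. -/
def IsNormalElement {A : Type*} [Ring A] (ω : A) : Prop :=
  Set.range (fun a : A => a * ω) = Set.range (fun a : A => ω * a)

namespace IsNormalElement

variable {A : Type*} [Ring A] {ω : A}

/-- The ideal `ω A` of a normal element `ω`, as a left ideal of `A`. -/
def ideal (h : IsNormalElement ω) : Ideal A where
  carrier := Set.range (fun a : A => ω * a)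
  add_mem' := by
    rintro _ _ ⟨a, rfl⟩ ⟨b, rfl⟩
    exact ⟨a + b, mul_add ω a b⟩
  zero_mem' := ⟨0, mul_zero ω⟩
  smul_mem' := by
    rintro c _ ⟨a, rfl⟩
    obtain ⟨c', hc'⟩ : c * ω ∈ Set.range (fun a : A => ω * a) := h ▸ ⟨c, rfl⟩
    refine ⟨c' * a, ?_⟩
    simp only at hc'
    simp only [smul_eq_mul, ← mul_assoc, hc']

/-- The ideal `ω A = A ω` is two-sided. -/
instance ideal_isTwoSided (h : IsNormalElement ω) : h.ideal.IsTwoSided where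
  mul_mem_of_left := by
    rintro _ b ⟨a, rfl⟩
    exact ⟨a * b, by simp only [mul_assoc]⟩

/-- The quotient algebra `A / ω A` by a normal element `ω`. -/
abbrev Quotient (h : IsNormalElement ω) : Type _ := A ⧸ h.ideal

end IsNormalElement

section Enveloping

variable (K : Type u) [Field K] (A : Type v) [Ring A] [Algebra K A]

/-- The enveloping algebra `A ⊗ Aᵒᵖ` of a `K`-algebra `A`. -/
abbrev EnvelopingAlgebra : Type v := A ⊗[K] Aᵐᵒᵖ

/-- `A` as a left module over its enveloping algebra, `(a ⊗ b) • x = a x b`. -/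
def regularEnvModule : ModuleCat.{v} (EnvelopingAlgebra K A) :=
  letI : Module (EnvelopingAlgebra K A) A := instModuleTensorProductMop K A
  ModuleCat.of (EnvelopingAlgebra K A) A

/-- The enveloping algebra as a left module over itself. -/
abbrev envSelfModule : ModuleCat.{v} (EnvelopingAlgebra K A) :=
  ModuleCat.of (EnvelopingAlgebra K A) (EnvelopingAlgebra K A)

variable {K A} in
/-- Right multiplication `x ↦ x r` by an element `r` of the enveloping algebra, as an endomorphism
of the enveloping algebra seen as a left module over itself. -/
def envRightMul (r : EnvelopingAlgebra K A) : envSelfModule K A ⟶ envSelfModule K A :=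
  ModuleCat.ofHom
    (LinearMap.toSpanSingleton (EnvelopingAlgebra K A) (EnvelopingAlgebra K A) r)

/-- The group `Ext^l` over the enveloping algebra of `A`, from `A` to the enveloping algebra. -/
def EnvExt (l : ℕ) : Type v :=
  Abelian.Ext.{v} (regularEnvModule K A) (envSelfModule K A) l

variable {K A}

lemma envRightMul_apply (r x : EnvelopingAlgebra K A) :
    (envRightMul r).hom x = x * r := rfl

lemma envRightMul_one : envRightMul (1 : EnvelopingAlgebra K A) = 𝟙 _ := by
  exact ModuleCat.hom_ext (LinearMap.ext fun x => mul_one x)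

lemma envRightMul_zero : envRightMul (0 : EnvelopingAlgebra K A) = 0 := by
  exact ModuleCat.hom_ext (LinearMap.ext fun x => mul_zero x)

lemma envRightMul_add (r s : EnvelopingAlgebra K A) :
    envRightMul (r + s) = envRightMul r + envRightMul s := by
  exact ModuleCat.hom_ext (LinearMap.ext fun x => mul_add x r s)

lemma envRightMul_mul (r s : EnvelopingAlgebra K A) :
    envRightMul (r * s) = envRightMul r ≫ envRightMul s := by
  exact ModuleCat.hom_ext (LinearMap.ext fun x => (mul_assoc x r s).symm)

lemma regularEnvModule_smul (a x : A) (b : Aᵐᵒᵖ) :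
    letI y : regularEnvModule K A := x
    ((a ⊗ₜ[K] b : EnvelopingAlgebra K A) • y : regularEnvModule K A) = a * x * b.unop := by
  change a * (x * b.unop) = _
  rw [mul_assoc]

namespace EnvExt

variable {l : ℕ}

instance : AddCommGroup (EnvExt K A l) :=
  inferInstanceAs (AddCommGroup (Abelian.Ext.{v} (regularEnvModule K A) (envSelfModule K A) l))

variable (K A l) in
/-- The identity map from `EnvExt K A l` to the underlying group `Ext^l`. -/
def toExt : EnvExt K A l ≃+ Abelian.Ext.{v} (regularEnvModule K A) (envSelfModule K A) l :=
  AddEquiv.refl _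

/-- The right action of the enveloping algebra on `Ext^l`, induced by its right multiplication
on the second argument of `Ext^l`. -/
def rightAct (ξ : EnvExt K A l) (r : EnvelopingAlgebra K A) : EnvExt K A l :=
  (toExt K A l).symm ((toExt K A l ξ).comp (Abelian.Ext.mk₀ (envRightMul r)) (add_zero l))

lemma toExt_rightAct (ξ : EnvExt K A l) (r : EnvelopingAlgebra K A) :
    toExt K A l (ξ.rightAct r) =
      (toExt K A l ξ).comp (Abelian.Ext.mk₀ (envRightMul r)) (add_zero l) := rfl

lemma rightAct_one (ξ : EnvExt K A l) : ξ.rightAct 1 = ξ := by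
  apply (toExt K A l).injective
  rw [toExt_rightAct, envRightMul_one, Abelian.Ext.comp_mk₀_id]

lemma rightAct_mul (ξ : EnvExt K A l) (r s : EnvelopingAlgebra K A) :
    ξ.rightAct (r * s) = (ξ.rightAct r).rightAct s := by
  apply (toExt K A l).injective
  rw [toExt_rightAct, toExt_rightAct, toExt_rightAct, envRightMul_mul,
    Abelian.Ext.comp_assoc_of_third_deg_zero, Abelian.Ext.mk₀_comp_mk₀]

lemma zero_rightAct (r : EnvelopingAlgebra K A) : (0 : EnvExt K A l).rightAct r = 0 := by
  apply (toExt K A l).injective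
  rw [toExt_rightAct, map_zero, Abelian.Ext.zero_comp]

lemma add_rightAct (ξ η : EnvExt K A l) (r : EnvelopingAlgebra K A) :
    (ξ + η).rightAct r = ξ.rightAct r + η.rightAct r := by
  apply (toExt K A l).injective
  rw [toExt_rightAct, map_add, map_add, toExt_rightAct, toExt_rightAct, Abelian.Ext.add_comp]

lemma rightAct_add (ξ : EnvExt K A l) (r s : EnvelopingAlgebra K A) :
    ξ.rightAct (r + s) = ξ.rightAct r + ξ.rightAct s := by
  apply (toExt K A l).injective
  rw [toExt_rightAct, map_add, toExt_rightAct, toExt_rightAct, envRightMul_add,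
    Abelian.Ext.mk₀_add, Abelian.Ext.comp_add]

lemma rightAct_zero (ξ : EnvExt K A l) : ξ.rightAct 0 = 0 := by
  apply (toExt K A l).injective
  rw [toExt_rightAct, map_zero, envRightMul_zero, Abelian.Ext.mk₀_zero, Abelian.Ext.comp_zero]

/-- `Ext^l` as a right module over the enveloping algebra. -/
instance : Module (EnvelopingAlgebra K A)ᵐᵒᵖ (EnvExt K A l) where
  smul r ξ := ξ.rightAct r.unop
  one_smul ξ := ξ.rightAct_one
  mul_smul r s ξ := ξ.rightAct_mul s.unop r.unop
  smul_zero r := zero_rightAct r.unop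
  smul_add r ξ η := add_rightAct ξ η r.unop
  add_smul r s ξ := ξ.rightAct_add r.unop s.unop
  zero_smul ξ := ξ.rightAct_zero

lemma op_smul_def (r : EnvelopingAlgebra K A) (ξ : EnvExt K A l) :
    op r • ξ = ξ.rightAct r := rfl

/-- The ring homomorphism `a ↦ 1 ⊗ a` from `A` to the opposite of its enveloping algebra. -/
def leftHom : A →+* (EnvelopingAlgebra K A)ᵐᵒᵖ where
  toFun a := op (1 ⊗ₜ[K] op a)
  map_one' := rfl
  map_mul' a b := by
    simp only [← op_mul, Algebra.TensorProduct.tmul_mul_tmul, one_mul]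
  map_zero' := by simp
  map_add' a b := by simp [TensorProduct.tmul_add]

/-- The ring homomorphism `b ↦ b ⊗ 1` from `Aᵒᵖ` to the opposite of the enveloping algebra. -/
def rightHom : Aᵐᵒᵖ →+* (EnvelopingAlgebra K A)ᵐᵒᵖ where
  toFun b := op (b.unop ⊗ₜ[K] 1)
  map_one' := rfl
  map_mul' a b := by
    simp only [← op_mul, Algebra.TensorProduct.tmul_mul_tmul, one_mul, unop_mul]
  map_zero' := by simp
  map_add' a b := by simp [TensorProduct.add_tmul]

/-- The left `A`-action on `Ext^l` coming from its right module structure over the enveloping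
algebra: `a` acts as `1 ⊗ a`, that is, through the inner bimodule structure
`a (x ⊗ y) b = x b ⊗ a y` of the enveloping algebra (the product `a y` being taken in `A`). -/
instance : Module A (EnvExt K A l) := Module.compHom _ (leftHom (K := K) (A := A))

/-- The right `A`-action on `Ext^l` coming from its right module structure over the enveloping
algebra: `b` acts as `b ⊗ 1`. -/
instance : Module Aᵐᵒᵖ (EnvExt K A l) := Module.compHom _ (rightHom (K := K) (A := A))

lemma smul_def (a : A) (ξ : EnvExt K A l) : a • ξ = ξ.rightAct (1 ⊗ₜ[K] op a) := rfl

lemma smul_op_def (b : A) (ξ : EnvExt K A l) : op b • ξ = ξ.rightAct (b ⊗ₜ[K] 1) := rfl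

instance : SMulCommClass A Aᵐᵒᵖ (EnvExt K A l) where
  smul_comm a b ξ := by
    change leftHom (K := K) a • rightHom (K := K) b • ξ =
      rightHom (K := K) b • leftHom (K := K) a • ξ
    rw [smul_smul, smul_smul]
    congr 1
    change op _ * op _ = op _ * op _
    simp only [← op_mul, Algebra.TensorProduct.tmul_mul_tmul, one_mul, mul_one]

end EnvExt

/-- The bimodule `A^ν` of an algebra endomorphism `ν` of `A`: it is `A` with left action
`a • m = a m` and right action `m • b = m ν(b)`. -/
def TwistedBimodule (_ν : A →ₐ[K] A) : Type v := A

namespace TwistedBimodule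

variable (ν : A →ₐ[K] A)

instance : AddCommGroup (TwistedBimodule ν) := inferInstanceAs (AddCommGroup A)

instance : Module A (TwistedBimodule ν) := inferInstanceAs (Module A A)

instance : Module Aᵐᵒᵖ (TwistedBimodule ν) :=
  Module.compHom A (AlgHom.op ν : Aᵐᵒᵖ →ₐ[K] Aᵐᵒᵖ).toRingHom

lemma smul_def (a m : A) : (a • (show TwistedBimodule ν from m) : TwistedBimodule ν) = a * m := rfl

lemma smul_op_def (b m : A) :
    (op b • (show TwistedBimodule ν from m) : TwistedBimodule ν) = m * ν b := rfl

instance : SMulCommClass A Aᵐᵒᵖ (TwistedBimodule ν) where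
  smul_comm a b m := (mul_assoc (a : A) (m : A) (ν b.unop)).symm

end TwistedBimodule

end Enveloping

/-- Two `A`-bimodules (with right actions written as left actions of `Aᵐᵒᵖ`) are isomorphic if
there is an additive bijection between them commuting with both actions. -/
def BimoduleIso (A : Type*) [Ring A] (M N : Type*) [AddCommGroup M] [Module A M] [Module Aᵐᵒᵖ M]
    [AddCommGroup N] [Module A N] [Module Aᵐᵒᵖ N] : Prop :=
  ∃ e : M ≃+ N, (∀ (a : A) (m : M), e (a • m) = a • e m) ∧
    ∀ (b : A) (m : M), e (op b • m) = op b • e m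

end

/-! The homomorphism `A^e → B^e` factors as `A ⊗ Aᵒᵖ → B ⊗ Aᵒᵖ → B ⊗ Bᵒᵖ`, and each factor is the
quotient by a normal regular element (`ω ⊗ 1`, then `1 ⊗ ω`). Rees' change of rings
(`reesHom_bijective`), used twice, gives `Ext^l_{B^e}(B, B^e) ≅ Ext^{l+2}_{A^e}(B, A^e)`.

The right-hand side is computed from `0 → A' → A → B → 0`, whose first map is right multiplication
by `ω`, that is, the action of `1 ⊗ ω`. This map is linear only after twisting its source by the
automorphism `τ` with `x r = τ(r) x`, where `x = 1 ⊗ ω`. Naturality of Ext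
(`ext_naturality_of_natTrans`) turns the induced map on `Ext(A, A^e)` into the right action of `1 ⊗
ω`, that is, left multiplication by `ω` on the bimodule Ext.

As `Ext^{d+1}(A, A^e) ≅ A^ν` is the only nonzero group and `ω` is injective on it, the long exact
sequence leaves only `A^ν / ω A^ν` in degree `d`, a free left `B`-module of rank one. The twists by
`τ` in the Rees map and in the connecting map cancel (`envδ_smul`). A bimodule free of rank one on
the left, with `K` acting centrally, is some `B^κ` (`exists_bimoduleIso_twistedBimodule`). -/

noncomputable section

/-! ### Naturality of Ext under transformations to the identity functor. -/

section NatTrans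

open Limits Abelian

universe w u₁ v₁

variable {C : Type u₁} [Category.{v₁} C] [Abelian C] [HasExt.{w} C] [EnoughProjectives C]

/-- A natural transformation from an exact endofunctor to the identity is natural with respect
to all classes in `Ext`. -/
lemma ext_naturality_of_natTrans (F : C ⥤ C) [F.Additive] [PreservesFiniteLimits F]
    [PreservesFiniteColimits F] (α : F ⟶ 𝟭 C) {X Y : C} {n : ℕ} (ξ : Ext X Y n) :
    (Ext.mk₀ (α.app X)).comp ξ (zero_add n) =
      (ξ.mapExactFunctor F).comp (Ext.mk₀ (α.app Y)) (add_zero n) := by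
  induction n generalizing X with
  | zero =>
    obtain ⟨f, rfl⟩ := (Ext.mk₀_bijective X Y).2 ξ
    have := α.naturality f
    dsimp at this
    simp only [Ext.mapExactFunctor_mk₀, Ext.mk₀_comp_mk₀]
    rw [this]
  | succ n hn =>
    let P : ProjectivePresentation X := Classical.arbitrary _
    let S := ShortComplex.mk _ _ (kernel.condition P.f)
    have hS : S.ShortExact := { exact := ShortComplex.exact_kernel P.f }
    have : Projective S.X₂ := P.projective
    -- Dimension shifting: the middle term is projective, so the class factors through the extension
    -- class of `S`.
    obtain ⟨η, rfl⟩ := Ext.contravariant_sequence_exact₃ hS Y ξ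
      (Ext.eq_zero_of_projective _) (add_comm 1 n)
    let t : S.map F ⟶ S :=
      { τ₁ := α.app S.X₁
        τ₂ := α.app S.X₂
        τ₃ := α.app S.X₃
        comm₁₂ := (α.naturality S.f).symm
        comm₂₃ := (α.naturality S.g).symm }
    have key := ShortComplex.ShortExact.extClass_naturality (hS.map_of_exact F) hS t
    change Ext.comp _ (Ext.mk₀ (α.app S.X₁)) _ = Ext.comp (Ext.mk₀ (α.app X)) _ _ at key
    have e₁ : (Ext.mk₀ (α.app X)).comp (hS.extClass.comp η (add_comm 1 n)) (zero_add (n + 1)) =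
        ((Ext.mk₀ (α.app X)).comp hS.extClass (zero_add 1)).comp η (add_comm 1 n) :=
      (Ext.comp_assoc _ _ _ (zero_add 1) (add_comm 1 n) (by lia)).symm
    rw [e₁, ← key, Ext.mapExactFunctor_comp, Ext.mapExactFunctor_extClass]
    refine (Ext.comp_assoc_of_second_deg_zero _ _ _ _).trans ?_
    rw [hn η]
    exact (Ext.comp_assoc_of_third_deg_zero _ _ _ _).symm

end NatTrans

/-! ### Quotients by normal regular elements, and their base change. -/

section NormalQuotient

/-- A surjective ring homomorphism whose kernel is generated, on either side, by the regular
element `x`. -/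
structure IsNormalQuotient {R S : Type*} [Ring R] [Ring S] (φ : R →+* S) (x : R) : Prop where
  surjective : Function.Surjective φ
  regular : IsRegular x
  exists_mul_left {r : R} : φ r = 0 → ∃ s, s * x = r
  exists_mul_right {r : R} : φ r = 0 → ∃ s, x * s = r
  map_eq_zero : φ x = 0

namespace IsNormalQuotient

variable {R S : Type*} [Ring R] [Ring S] {φ : R →+* S} {x : R}

lemma exists_mul_eq (h : IsNormalQuotient φ x) (r : R) : ∃ s, s * x = x * r :=
  h.exists_mul_left (by simp [h.map_eq_zero])

lemma exists_eq_mul (h : IsNormalQuotient φ x) (r : R) : ∃ s, x * s = r * x :=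
  h.exists_mul_right (by simp [h.map_eq_zero])

/-- Conjugation by a normal regular element: the automorphism `τ` with `x r = τ(r) x`. -/
def conj (h : IsNormalQuotient φ x) : R ≃+* R where
  toFun r := (h.exists_mul_eq r).choose
  invFun r := (h.exists_eq_mul r).choose
  left_inv r := h.regular.left <| by
    change x * _ = x * _
    rw [(h.exists_eq_mul _).choose_spec, (h.exists_mul_eq r).choose_spec]
  right_inv r := h.regular.right <| by
    change _ * x = _ * x
    rw [(h.exists_mul_eq _).choose_spec, (h.exists_eq_mul r).choose_spec]
  map_mul' r s := h.regular.right <| by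
    change _ * x = _ * _ * x
    rw [(h.exists_mul_eq _).choose_spec, mul_assoc, (h.exists_mul_eq s).choose_spec,
      ← mul_assoc _ x, (h.exists_mul_eq r).choose_spec, mul_assoc]
  map_add' r s := h.regular.right <| by
    change _ * x = (_ + _) * x
    rw [(h.exists_mul_eq _).choose_spec, add_mul, (h.exists_mul_eq s).choose_spec,
      (h.exists_mul_eq r).choose_spec, mul_add]

lemma conj_mul (h : IsNormalQuotient φ x) (r : R) : h.conj r * x = x * r :=
  (h.exists_mul_eq r).choose_spec

lemma conj_eq (h : IsNormalQuotient φ x) {r s : R} (hs : s * x = x * r) : h.conj r = s :=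
  h.regular.right ((h.conj_mul r).trans hs.symm)

lemma conj_self (h : IsNormalQuotient φ x) : h.conj x = x := h.conj_eq rfl

protected lemma op (h : IsNormalQuotient φ x) : IsNormalQuotient φ.op (op x) where
  surjective b := by
    obtain ⟨a, ha⟩ := h.surjective b.unop
    exact ⟨op a, by simp [ha]⟩
  regular := ⟨fun a b hab => unop_injective (h.regular.right (op_injective hab)),
    fun a b hab => unop_injective (h.regular.left (op_injective hab))⟩
  exists_mul_left {r} hr := by
    obtain ⟨s, hs⟩ := h.exists_mul_right (r := r.unop) (op_injective hr)
    exact ⟨op s, unop_injective hs⟩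
  exists_mul_right {r} hr := by
    obtain ⟨s, hs⟩ := h.exists_mul_left (r := r.unop) (op_injective hr)
    exact ⟨op s, unop_injective hs⟩
  map_eq_zero := by simp [h.map_eq_zero]

end IsNormalQuotient

lemma IsNormalElement.isNormalQuotient {A : Type*} [Ring A] {ω : A} (h : IsNormalElement ω)
    (hreg : IsRegular ω) : IsNormalQuotient (Ideal.Quotient.mk h.ideal) ω where
  surjective := Ideal.Quotient.mk_surjective
  regular := hreg
  exists_mul_left {r} hr := by
    have : r ∈ Set.range (fun a : A => ω * a) := Ideal.Quotient.eq_zero_iff_mem.1 hr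
    rw [← h] at this
    exact this
  exists_mul_right {r} hr := Ideal.Quotient.eq_zero_iff_mem.1 hr
  map_eq_zero := Ideal.Quotient.eq_zero_iff_mem.2 ⟨1, mul_one ω⟩

section Tensor

variable {K : Type*} [Field K] {A B : Type*} [Ring A] [Algebra K A] [Ring B] [Algebra K B]
  (C : Type*) [Ring C] [Algebra K C] {φ : A →ₐ[K] B} {x : A}

/-- Over a field `C` is flat, so multiplication by `x` stays injective on both sides; right
exactness of the tensor product identifies the kernel. -/
lemma IsNormalQuotient.map_id (h : IsNormalQuotient (φ : A →+* B) x) :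
    IsNormalQuotient (Algebra.TensorProduct.map φ (AlgHom.id K C) : A ⊗[K] C →+* B ⊗[K] C)
      (x ⊗ₜ[K] (1 : C)) := by
  have hl (y : A ⊗[K] C) : (LinearMap.mulLeft K x).rTensor C y = x ⊗ₜ[K] (1 : C) * y := by
    induction y with
    | zero => simp
    | add y z hy hz => rw [map_add, hy, hz, mul_add]
    | tmul a c => simp
  have hr (y : A ⊗[K] C) : (LinearMap.mulRight K x).rTensor C y = y * x ⊗ₜ[K] (1 : C) := by
    induction y with
    | zero => simp
    | add y z hy hz => rw [map_add, hy, hz, add_mul]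
    | tmul a c => simp
  have hsurj : Function.Surjective φ.toLinearMap := h.surjective
  have hx : φ x = 0 := h.map_eq_zero
  refine ⟨?_, ⟨?_, ?_⟩, ?_, ?_, ?_⟩
  · exact LinearMap.rTensor_surjective C hsurj
  · intro y z hyz
    refine Module.Flat.rTensor_preserves_injective_linearMap (M := C) (LinearMap.mulLeft K x)
      (fun a b hab => h.regular.left hab) ?_
    rw [hl, hl]
    exact hyz
  · intro y z hyz
    refine Module.Flat.rTensor_preserves_injective_linearMap (M := C) (LinearMap.mulRight K x)
      (fun a b hab => h.regular.right hab) ?_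
    rw [hr, hr]
    exact hyz
  · intro y hy
    have hex : Function.Exact (LinearMap.mulRight K x) φ.toLinearMap := by
      refine fun a => ⟨fun ha => h.exists_mul_left ha, ?_⟩
      rintro ⟨b, rfl⟩
      simp [hx]
    obtain ⟨s, hs⟩ := (rTensor_exact C hex hsurj y).1 hy
    exact ⟨s, by rw [← hr, hs]⟩
  · intro y hy
    have hex : Function.Exact (LinearMap.mulLeft K x) φ.toLinearMap := by
      refine fun a => ⟨fun ha => h.exists_mul_right ha, ?_⟩
      rintro ⟨b, rfl⟩
      simp [hx]
    obtain ⟨s, hs⟩ := (rTensor_exact C hex hsurj y).1 hy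
    exact ⟨s, by rw [← hl, hs]⟩
  · simp [hx]

lemma IsNormalQuotient.id_map (h : IsNormalQuotient (φ : A →+* B) x) :
    IsNormalQuotient (Algebra.TensorProduct.map (AlgHom.id K C) φ : C ⊗[K] A →+* C ⊗[K] B)
      ((1 : C) ⊗ₜ[K] x) := by
  have hl (y : C ⊗[K] A) : (LinearMap.mulLeft K x).lTensor C y = (1 : C) ⊗ₜ[K] x * y := by
    induction y with
    | zero => simp
    | add y z hy hz => rw [map_add, hy, hz, mul_add]
    | tmul a c => simp
  have hr (y : C ⊗[K] A) : (LinearMap.mulRight K x).lTensor C y = y * (1 : C) ⊗ₜ[K] x := by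
    induction y with
    | zero => simp
    | add y z hy hz => rw [map_add, hy, hz, add_mul]
    | tmul a c => simp
  have hsurj : Function.Surjective φ.toLinearMap := h.surjective
  have hx : φ x = 0 := h.map_eq_zero
  refine ⟨?_, ⟨?_, ?_⟩, ?_, ?_, ?_⟩
  · exact LinearMap.lTensor_surjective C hsurj
  · intro y z hyz
    refine Module.Flat.lTensor_preserves_injective_linearMap (M := C) (LinearMap.mulLeft K x)
      (fun a b hab => h.regular.left hab) ?_
    rw [hl, hl]
    exact hyz
  · intro y z hyz
    refine Module.Flat.lTensor_preserves_injective_linearMap (M := C) (LinearMap.mulRight K x)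
      (fun a b hab => h.regular.right hab) ?_
    rw [hr, hr]
    exact hyz
  · intro y hy
    have hex : Function.Exact (LinearMap.mulRight K x) φ.toLinearMap := by
      refine fun a => ⟨fun ha => h.exists_mul_left ha, ?_⟩
      rintro ⟨b, rfl⟩
      simp [hx]
    obtain ⟨s, hs⟩ := (lTensor_exact C hex hsurj y).1 hy
    exact ⟨s, by rw [← hr, hs]⟩
  · intro y hy
    have hex : Function.Exact (LinearMap.mulLeft K x) φ.toLinearMap := by
      refine fun a => ⟨fun ha => h.exists_mul_right ha, ?_⟩
      rintro ⟨b, rfl⟩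
      simp [hx]
    obtain ⟨s, hs⟩ := (lTensor_exact C hex hsurj y).1 hy
    exact ⟨s, by rw [← hl, hs]⟩
  · simp [hx]

end Tensor

end NormalQuotient

/-! ### Restriction of scalars as an exact functor. -/

section RestrictScalars

open Limits Abelian

variable {R S : Type v} [Ring R] [Ring S] (φ : R →+* S)

lemma restrictScalars_map_exact (T : ShortComplex (ModuleCat.{v} S)) (h : T.Exact) :
    (T.map (ModuleCat.restrictScalars.{v} φ)).Exact := by
  rw [ShortComplex.ShortExact.moduleCat_exact_iff_function_exact] at h ⊢
  exact h

instance restrictScalars_preservesFiniteLimits :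
    PreservesFiniteLimits (ModuleCat.restrictScalars.{v} φ) := by
  have := ((Functor.exact_tfae (ModuleCat.restrictScalars.{v} φ)).out 1 3).mp
    (restrictScalars_map_exact φ)
  exact this.1

instance restrictScalars_preservesFiniteColimits :
    PreservesFiniteColimits (ModuleCat.restrictScalars.{v} φ) := by
  have := ((Functor.exact_tfae (ModuleCat.restrictScalars.{v} φ)).out 1 3).mp
    (restrictScalars_map_exact φ)
  exact this.2

variable {φ} in
lemma restrictScalars_full (hφ : Function.Surjective φ) :
    (ModuleCat.restrictScalars.{v} φ).Full where
  map_surjective {M N} f := by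
    refine ⟨ModuleCat.ofHom { f.hom.toAddMonoidHom with map_smul' := fun s m => ?_ }, ?_⟩
    · obtain ⟨r, rfl⟩ := hφ s
      exact f.hom.map_smul r m
    · rfl

/-- An additive map semilinear with respect to `φ`, as a morphism out of a restriction of
scalars. -/
def ofRestrictScalars {N : ModuleCat.{v} S} {M : ModuleCat.{v} R} (g : N →+ M)
    (hg : ∀ (r : R) (n : N), g (φ r • n) = r • g n) : (ModuleCat.restrictScalars φ).obj N ⟶ M :=
  ModuleCat.ofHom (X := (ModuleCat.restrictScalars φ).obj N) { g with map_smul' := hg }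

/-- A map `f` with `f (r m) = φ(r) f(m)`, as a morphism into a restriction of scalars. -/
def toRestrictScalars {N : ModuleCat.{v} S} {M : ModuleCat.{v} R} (g : M →+ N)
    (hg : ∀ (r : R) (m : M), g (r • m) = φ r • g m) : M ⟶ (ModuleCat.restrictScalars φ).obj N :=
  ModuleCat.ofHom (Y := (ModuleCat.restrictScalars φ).obj N) { g with map_smul' := hg }

/-- Right multiplication by `r` as an endomorphism of the left module `R`. -/
def rightMul (r : R) : ModuleCat.of R R ⟶ ModuleCat.of R R :=
  ModuleCat.ofHom (LinearMap.toSpanSingleton R R r)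

lemma rightMul_comp (r s : R) : rightMul r ≫ rightMul s = rightMul (r * s) :=
  ModuleCat.hom_ext (LinearMap.ext fun x => mul_assoc x r s)

end RestrictScalars

/-! ### Rees' change of rings theorem. -/

namespace IsNormalQuotient

open Limits Abelian

variable {R S : Type v} [Ring R] [Ring S] {φ : R →+* S} {x : R}

lemma map_mul_right (h : IsNormalQuotient φ x) (r : R) : φ (r * x) = 0 := by
  rw [map_mul, h.map_eq_zero, mul_zero]

/-- The short exact sequence `0 → R → R → S → 0` of left `R`-modules whose first map is right
multiplication by `x`. -/
def shortComplex (h : IsNormalQuotient φ x) : ShortComplex (ModuleCat.{v} R) where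
  X₁ := ModuleCat.of R R
  X₂ := ModuleCat.of R R
  X₃ := (ModuleCat.restrictScalars φ).obj (ModuleCat.of S S)
  f := rightMul x
  g := toRestrictScalars φ (N := ModuleCat.of S S) (M := ModuleCat.of R R) φ.toAddMonoidHom
    fun r m => φ.map_mul r m
  zero := ModuleCat.hom_ext (LinearMap.ext fun r => h.map_mul_right r)

lemma shortExact (h : IsNormalQuotient φ x) : h.shortComplex.ShortExact := by
  refine ModuleCat.shortComplex_shortExact _ (fun r => ⟨fun hr => h.exists_mul_left hr, ?_⟩)
    h.regular.right h.surjective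
  rintro ⟨s, rfl⟩
  exact h.map_mul_right s

/-- The short exact sequence `0 → R^(I) → R^(I) → S^(I) → 0` of left `R`-modules whose first map
is right multiplication by `x`. -/
def finsuppShortComplex (h : IsNormalQuotient φ x) (I : Type v) :
    ShortComplex (ModuleCat.{v} R) where
  X₁ := ModuleCat.of R (I →₀ R)
  X₂ := ModuleCat.of R (I →₀ R)
  X₃ := (ModuleCat.restrictScalars φ).obj (ModuleCat.of S (I →₀ S))
  f := ModuleCat.ofHom (Finsupp.mapRange.linearMap (LinearMap.toSpanSingleton R R x))
  g := toRestrictScalars φ (N := ModuleCat.of S (I →₀ S)) (M := ModuleCat.of R (I →₀ R))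
    (Finsupp.mapRange.addMonoidHom φ.toAddMonoidHom)
    fun r m => Finsupp.ext fun i => φ.map_mul r (m i)
  zero := ModuleCat.hom_ext (LinearMap.ext fun m => Finsupp.ext fun i => h.map_mul_right (m i))

lemma finsuppShortExact (h : IsNormalQuotient φ x) (I : Type v) :
    (h.finsuppShortComplex I).ShortExact := by
  refine ModuleCat.shortComplex_shortExact _ (fun (m : I →₀ R) => ⟨fun hm => ?_, ?_⟩) ?_ ?_
  · have hm' (i : I) : φ (m i) = 0 := DFunLike.congr_fun (F := I →₀ S) hm i
    choose s hs using fun i => h.exists_mul_left (hm' i)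
    refine ⟨Finsupp.onFinset m.support s fun i hi => ?_, Finsupp.ext fun i => hs i⟩
    rw [Finsupp.mem_support_iff, ← hs i]
    exact fun h0 => hi (h.regular.right (h0.trans (zero_mul x).symm))
  · rintro ⟨(n : I →₀ R), rfl⟩
    exact Finsupp.ext fun i => h.map_mul_right (n i)
  · exact Finsupp.mapRange_injective (fun r : R => r * x) (zero_mul x) h.regular.right
  · exact Finsupp.mapRange_surjective φ (map_zero φ) h.surjective

/-- A homomorphism `R^(I) → R` induces a morphism of short exact sequences, by normality. -/
lemma exists_hom_finsuppShortComplex (h : IsNormalQuotient φ x) (I : Type v)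
    (g : ModuleCat.of R (I →₀ R) ⟶ ModuleCat.of R R) :
    ∃ t : h.finsuppShortComplex I ⟶ h.shortComplex, t.τ₁ = g := by
  -- The middle map must send `eᵢ` to the element `g'ᵢ` with `x g'ᵢ = g(eᵢ) x`; this makes the left
  -- square commute.
  choose g' hg' using fun i => h.exists_eq_mul (g.hom (Finsupp.single i 1))
  let G : (I →₀ R) →ₗ[R] R := Finsupp.linearCombination R g'
  let G' : (I →₀ S) →ₗ[S] S := Finsupp.linearCombination S fun i => φ (g' i)
  refine ⟨{ τ₁ := g, τ₂ := ModuleCat.ofHom G,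
            τ₃ := (ModuleCat.restrictScalars φ).map (ModuleCat.ofHom G'),
            comm₁₂ := ?_, comm₂₃ := ?_ }, rfl⟩
  · refine ModuleCat.hom_ext (Finsupp.lhom_ext' fun i => LinearMap.ext_ring ?_)
    change g.hom (Finsupp.single i 1) * x = G (Finsupp.mapRange (fun r : R => r * x) (zero_mul x)
      (Finsupp.single i 1))
    rw [Finsupp.mapRange_single, one_mul, Finsupp.linearCombination_single, smul_eq_mul, hg']
  · refine ModuleCat.hom_ext (Finsupp.lhom_ext' fun i => LinearMap.ext_ring ?_)
    change φ (G (Finsupp.single i 1)) = G' (Finsupp.mapRange φ (map_zero φ) (Finsupp.single i 1))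
    rw [Finsupp.mapRange_single, Finsupp.linearCombination_single,
      Finsupp.linearCombination_single, smul_eq_mul, smul_eq_mul, map_mul]

/-- `S^(I)` has a free resolution of length one over `R`. -/
lemma ext_finsupp_eq_zero (h : IsNormalQuotient φ x) (I : Type v) {n : ℕ}
    (y : Ext ((ModuleCat.restrictScalars φ).obj (ModuleCat.of S (I →₀ S))) (ModuleCat.of R R)
      (n + 2)) : y = 0 := by
  have hS := h.finsuppShortExact I
  have h₂ : Projective (ModuleCat.of R (I →₀ R)) := inferInstance
  have h₂' : Projective (h.finsuppShortComplex I).X₂ := h₂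
  have h₁' : Projective (h.finsuppShortComplex I).X₁ := h₂
  obtain ⟨z, rfl⟩ := Ext.contravariant_sequence_exact₃ hS _ y (Ext.eq_zero_of_projective _)
    (n₀ := n + 1) (by lia)
  rw [Ext.eq_zero_of_projective z]
  exact Ext.comp_zero _ _ _ _ _

/-- The class `y` is the image of some `g : R^(I) → R` under the connecting map. Completing `g` to a
morphism of short exact sequences moves it to the quotient side, where its third component is `u`.
-/
lemma exists_comp_extClass_of_finsupp (h : IsNormalQuotient φ x) (I : Type v)
    (y : Ext ((ModuleCat.restrictScalars φ).obj (ModuleCat.of S (I →₀ S))) (ModuleCat.of R R) 1) :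
    ∃ u : (ModuleCat.restrictScalars φ).obj (ModuleCat.of S (I →₀ S)) ⟶ h.shortComplex.X₃,
      (Ext.mk₀ u).comp h.shortExact.extClass (zero_add 1) = y := by
  have hS := h.finsuppShortExact I
  have h₂ : Projective (ModuleCat.of R (I →₀ R)) := inferInstance
  have h₂' : Projective (h.finsuppShortComplex I).X₂ := h₂
  obtain ⟨z, rfl⟩ := Ext.contravariant_sequence_exact₃ hS _ y (Ext.eq_zero_of_projective _)
    (n₀ := 0) (by lia)
  obtain ⟨g, rfl⟩ := (Ext.mk₀_bijective _ _).2 z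
  obtain ⟨t, ht⟩ := h.exists_hom_finsuppShortComplex I g
  have := ShortComplex.ShortExact.extClass_naturality hS h.shortExact t
  exact ⟨t.τ₃, by rw [← ht]; exact this.symm⟩

/-- The element `x` kills `N` but is regular on `R`. -/
lemma hom_restrictScalars_eq_zero (h : IsNormalQuotient φ x) {N : ModuleCat.{v} S}
    (f : (ModuleCat.restrictScalars φ).obj N ⟶ ModuleCat.of R R) : f = 0 := by
  refine ModuleCat.hom_ext (LinearMap.ext fun n => h.regular.left ?_)
  change x * f.hom n = x * 0
  rw [mul_zero, ← smul_eq_mul, ← map_smul]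
  have : x • n = 0 := by
    change φ x • (show N from n) = 0
    rw [h.map_eq_zero, zero_smul]
  rw [this, map_zero]

/-- The change of rings map `Ext_S^n(N, S) → Ext_R^{n+1}(N, R)`. -/
def reesHom (h : IsNormalQuotient φ x) (N : ModuleCat.{v} S) (n : ℕ) :
    Ext.{v} N (ModuleCat.of S S) n →+
      Ext.{v} ((ModuleCat.restrictScalars φ).obj N) (ModuleCat.of R R) (n + 1) :=
  (h.shortExact.extClass.postcomp ((ModuleCat.restrictScalars φ).obj N) rfl).comp
    ((ModuleCat.restrictScalars φ).mapExtAddHom N (ModuleCat.of S S) n)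

lemma reesHom_apply (h : IsNormalQuotient φ x) (N : ModuleCat.{v} S) (n : ℕ)
    (ξ : Ext.{v} N (ModuleCat.of S S) n) :
    h.reesHom N n ξ =
      (ξ.mapExactFunctor (ModuleCat.restrictScalars φ)).comp h.shortExact.extClass rfl := rfl

lemma reesHom_mk₀_comp (h : IsNormalQuotient φ x) {N N' : ModuleCat.{v} S} (f : N ⟶ N') {n : ℕ}
    (ξ : Ext.{v} N' (ModuleCat.of S S) n) :
    h.reesHom N n ((Ext.mk₀ f).comp ξ (zero_add n)) =
      (Ext.mk₀ ((ModuleCat.restrictScalars φ).map f)).comp (h.reesHom N' n ξ)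
        (zero_add (n + 1)) := by
  rw [reesHom_apply, reesHom_apply, Ext.mapExactFunctor_comp, Ext.mapExactFunctor_mk₀]
  exact Ext.comp_assoc _ _ _ _ _ (by lia)

lemma reesHom_extClass_comp (h : IsNormalQuotient φ x) {T : ShortComplex (ModuleCat.{v} S)}
    (hT : T.ShortExact) {n : ℕ} (ξ : Ext.{v} T.X₁ (ModuleCat.of S S) n) :
    h.reesHom T.X₃ (n + 1) (hT.extClass.comp ξ (add_comm 1 n)) =
      (hT.map_of_exact (ModuleCat.restrictScalars φ)).extClass.comp (h.reesHom T.X₁ n ξ)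
        (add_comm 1 (n + 1)) := by
  rw [reesHom_apply, reesHom_apply, Ext.mapExactFunctor_comp, Ext.mapExactFunctor_extClass]
  exact Ext.comp_assoc _ _ _ _ _ (by lia)

lemma reesHom_zero_injective (h : IsNormalQuotient φ x) (N : ModuleCat.{v} S) :
    Function.Injective (h.reesHom N 0) := by
  refine (injective_iff_map_eq_zero _).2 fun ξ hξ => ?_
  obtain ⟨f, rfl⟩ := (Ext.mk₀_bijective _ _).2 ξ
  rw [reesHom_apply, Ext.mapExactFunctor_mk₀] at hξ
  obtain ⟨y, hy⟩ := Ext.covariant_sequence_exact₃ _ h.shortExact _ _ hξ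
  obtain ⟨g, rfl⟩ := (Ext.mk₀_bijective _ _).2 y
  have hg : g = 0 := h.hom_restrictScalars_eq_zero g
  rw [hg, Ext.mk₀_zero, Ext.zero_comp] at hy
  have h0 : (ModuleCat.restrictScalars φ).map f = 0 := (Ext.mk₀_eq_zero_iff _).1 hy.symm
  rw [Ext.mk₀_eq_zero_iff]
  exact (ModuleCat.restrictScalars φ).map_injective (h0.trans (Functor.map_zero _ _ _).symm)

lemma reesHom_zero_surjective_of_finsupp (h : IsNormalQuotient φ x) (I : Type v) :
    Function.Surjective (h.reesHom (ModuleCat.of S (I →₀ S)) 0) := by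
  intro y
  obtain ⟨u, rfl⟩ := h.exists_comp_extClass_of_finsupp I y
  have := restrictScalars_full h.surjective
  obtain ⟨f, rfl⟩ := (ModuleCat.restrictScalars φ).map_surjective u
  exact ⟨Ext.mk₀ f, by rw [reesHom_apply, Ext.mapExactFunctor_mk₀]; rfl⟩

/-- Every module is the quotient of a free module `S^(N)`. -/
def freeShortComplex (N : ModuleCat.{v} S) : ShortComplex (ModuleCat.{v} S) :=
  (Finsupp.linearCombination S (id : N → N)).shortComplexKer

lemma freeShortExact (N : ModuleCat.{v} S) : (freeShortComplex N).ShortExact :=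
  LinearMap.shortExact_shortComplexKer (Finsupp.linearCombination_id_surjective S N)

/-- A preimage `u` is found over `T.X₂`; it vanishes on `T.X₁` by injectivity, hence descends to `v`
on `T.X₃`. The error `reesHom v - y` comes from `Hom_R(T.X₁, R) = 0`. -/
lemma reesHom_zero_surjective_of_shortExact (h : IsNormalQuotient φ x)
    {T : ShortComplex (ModuleCat.{v} S)} (hT : T.ShortExact)
    (h₂ : Function.Surjective (h.reesHom T.X₂ 0)) : Function.Surjective (h.reesHom T.X₃ 0) := by
  intro y
  have hFT := hT.map_of_exact (ModuleCat.restrictScalars φ)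
  obtain ⟨u, hu⟩ := h₂ ((Ext.mk₀ ((ModuleCat.restrictScalars φ).map T.g)).comp y (zero_add 1))
  have h0 : (Ext.mk₀ T.f).comp u (zero_add 0) = 0 := by
    apply h.reesHom_zero_injective
    rw [map_zero, h.reesHom_mk₀_comp, hu, Ext.mk₀_comp_mk₀_assoc, ← Functor.map_comp, T.zero,
      Functor.map_zero, Ext.mk₀_zero, Ext.zero_comp]
  obtain ⟨v, rfl⟩ := Ext.contravariant_sequence_exact₂ hT _ u h0
  refine ⟨v, ?_⟩
  have hsub : (Ext.mk₀ ((ModuleCat.restrictScalars φ).map T.g)).comp (h.reesHom T.X₃ 0 v - y)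
      (zero_add 1) = 0 := by
    rw [sub_eq_add_neg, Ext.comp_add, Ext.comp_neg, ← sub_eq_add_neg, sub_eq_zero, ← hu,
      h.reesHom_mk₀_comp]
  obtain ⟨w, hw⟩ := Ext.contravariant_sequence_exact₃ hFT _ (h.reesHom T.X₃ 0 v - y) (n₀ := 0)
    hsub rfl
  obtain ⟨g, rfl⟩ := (Ext.mk₀_bijective _ _).2 w
  have hg : g = 0 := h.hom_restrictScalars_eq_zero g
  rw [hg, Ext.mk₀_zero, Ext.comp_zero] at hw
  exact sub_eq_zero.1 hw.symm

lemma reesHom_zero_surjective (h : IsNormalQuotient φ x) (N : ModuleCat.{v} S) :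
    Function.Surjective (h.reesHom N 0) :=
  h.reesHom_zero_surjective_of_shortExact (freeShortExact N)
    (h.reesHom_zero_surjective_of_finsupp N)

/-- Rees' change of rings theorem. -/
theorem reesHom_bijective (h : IsNormalQuotient φ x) (N : ModuleCat.{v} S) (n : ℕ) :
    Function.Bijective (h.reesHom N n) := by
  induction n generalizing N with
  | zero => exact ⟨h.reesHom_zero_injective N, h.reesHom_zero_surjective N⟩
  | succ n ih =>
    have hT := freeShortExact N
    have hFT := hT.map_of_exact (ModuleCat.restrictScalars φ)
    have hP : Projective (ModuleCat.of S (N →₀ S)) := inferInstance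
    have hP' : Projective (freeShortComplex N).X₂ := hP
    -- Both connecting maps are surjective, since the free module `F` has `Ext_S^{n+1}(F, S) = 0`
    -- and `Ext_R^{n+2}(F, R) = 0`. So degree `n + 1` is a cokernel of degree `n` terms on either
    -- side.
    refine AddMonoidHom.bijective_of_surjective_of_bijective_of_right_exact
      ((Ext.mk₀ (freeShortComplex N).f).precomp (ModuleCat.of S S) (zero_add n))
      (hT.extClass.precomp (ModuleCat.of S S) (add_comm 1 n))
      ((Ext.mk₀ ((freeShortComplex N).map (ModuleCat.restrictScalars φ)).f).precomp
        (ModuleCat.of R R) (zero_add (n + 1)))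
      (hFT.extClass.precomp (ModuleCat.of R R) (add_comm 1 (n + 1)))
      (h.reesHom (freeShortComplex N).X₂ n) (h.reesHom (freeShortComplex N).X₁ n)
      (h.reesHom (freeShortComplex N).X₃ (n + 1)) ?_ ?_
      ((ShortComplex.ab_exact_iff_function_exact _).1
        (Ext.contravariant_sequence_exact₁' hT _ n (n + 1) (add_comm 1 n)))
      ((ShortComplex.ab_exact_iff_function_exact _).1
        (Ext.contravariant_sequence_exact₁' hFT _ (n + 1) (n + 2) (add_comm 1 (n + 1))))
      (ih _).surjective (ih _) ?_ ?_
    · exact AddMonoidHom.ext fun ξ => (h.reesHom_mk₀_comp _ ξ).symm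
    · exact AddMonoidHom.ext fun ξ => (h.reesHom_extClass_comp hT ξ).symm
    · exact fun y => Ext.contravariant_sequence_exact₃ hT _ y (Ext.eq_zero_of_projective _) (add_comm 1 n)
    · exact fun y => Ext.contravariant_sequence_exact₃ hFT _ y (h.ext_finsupp_eq_zero N _)
        (add_comm 1 (n + 1))

/-- Compatibility of the change of rings map with right multiplications. -/
lemma reesHom_comp_rightMul (h : IsNormalQuotient φ x) (N : ModuleCat.{v} S) {n : ℕ}
    (ξ : Ext.{v} N (ModuleCat.of S S) n) (r : R) :
    h.reesHom N n (ξ.comp (Ext.mk₀ (rightMul (φ r))) (add_zero n)) =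
      (h.reesHom N n ξ).comp (Ext.mk₀ (rightMul (h.conj r))) (add_zero (n + 1)) := by
  -- Right multiplication by `r` on the middle term restricts to `conj r` on the submodule because
  -- `(s x) r = (s · conj r) x`.
  let t : h.shortComplex ⟶ h.shortComplex :=
    { τ₁ := rightMul (h.conj r)
      τ₂ := rightMul r
      τ₃ := (ModuleCat.restrictScalars φ).map (rightMul (φ r))
      comm₁₂ := by
        change rightMul _ ≫ rightMul _ = rightMul _ ≫ rightMul _
        rw [rightMul_comp, rightMul_comp, h.conj_mul]
      comm₂₃ := ModuleCat.hom_ext (LinearMap.ext fun s => φ.map_mul s r) }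
  have key := ShortComplex.ShortExact.extClass_naturality h.shortExact h.shortExact t
  rw [reesHom_apply, reesHom_apply, Ext.mapExactFunctor_comp, Ext.mapExactFunctor_mk₀]
  refine (Ext.comp_assoc_of_second_deg_zero _ _ _ _).trans ?_
  refine Eq.trans ?_ (Ext.comp_assoc_of_third_deg_zero _ _ _ _).symm
  exact congrArg (fun z => Ext.comp _ z _) key.symm

end IsNormalQuotient

/-! ### Twisting by conjugation, and the long exact sequence of `N / x N`. -/

namespace IsNormalQuotient

open Limits Abelian

variable {R S : Type v} [Ring R] [Ring S] {φ : R →+* S} {x : R}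

/-- Twisting modules along the inverse of the automorphism `h.conj`. -/
abbrev twist (h : IsNormalQuotient φ x) : ModuleCat.{v} R ⥤ ModuleCat.{v} R :=
  ModuleCat.restrictScalars h.conj.symm.toRingHom

/-- Multiplication by the normal element `x`, as a natural transformation. -/
def twistToId (h : IsNormalQuotient φ x) : h.twist ⟶ 𝟭 (ModuleCat.{v} R) where
  app N := ofRestrictScalars h.conj.symm.toRingHom (N := N) (M := N)
    (DistribSMul.toAddMonoidHom N x) fun r n => by
      change x • h.conj.symm r • n = r • x • n
      rw [smul_smul, smul_smul, ← h.conj_mul, RingEquiv.apply_symm_apply]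
  naturality M N f := ModuleCat.hom_ext (LinearMap.ext fun m => (f.hom.map_smul x m).symm)

/-- The twist of the left module `R` is isomorphic to `R`. -/
def twistSelf (h : IsNormalQuotient φ x) :
    h.twist.obj (ModuleCat.of R R) ⟶ ModuleCat.of R R :=
  ofRestrictScalars h.conj.symm.toRingHom (N := ModuleCat.of R R) (M := ModuleCat.of R R)
    (h.conj : R →+ R) fun r n => by
      change h.conj (h.conj.symm r * n) = r * h.conj n
      rw [map_mul, RingEquiv.apply_symm_apply]

instance (h : IsNormalQuotient φ x) : IsIso h.twistSelf :=
  (ConcreteCategory.isIso_iff_bijective h.twistSelf).2 h.conj.bijective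

lemma twistToId_app_self (h : IsNormalQuotient φ x) :
    h.twistToId.app (ModuleCat.of R R) = h.twistSelf ≫ rightMul x :=
  ModuleCat.hom_ext (LinearMap.ext fun r => (h.conj_mul r).symm)

lemma map_rightMul_comp_twistSelf (h : IsNormalQuotient φ x) (r : R) :
    h.twist.map (rightMul r) ≫ h.twistSelf = h.twistSelf ≫ rightMul (h.conj r) :=
  ModuleCat.hom_ext (LinearMap.ext fun s => map_mul h.conj (show R from s) r)

/-- The isomorphism between `Ext^n(N, R)` and `Ext^n` from the twist of `N` to `R`. -/
def twistHom (h : IsNormalQuotient φ x) (N : ModuleCat.{v} R) (n : ℕ) :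
    Ext.{v} N (ModuleCat.of R R) n →+ Ext.{v} (h.twist.obj N) (ModuleCat.of R R) n :=
  ((Ext.mk₀ h.twistSelf).postcomp (h.twist.obj N) (add_zero n)).comp
    (h.twist.mapExtAddHom N (ModuleCat.of R R) n)

lemma twistHom_apply (h : IsNormalQuotient φ x) (N : ModuleCat.{v} R) (n : ℕ)
    (ξ : Ext.{v} N (ModuleCat.of R R) n) :
    h.twistHom N n ξ = (ξ.mapExactFunctor h.twist).comp (Ext.mk₀ h.twistSelf) (add_zero n) := rfl

lemma twistHom_bijective (h : IsNormalQuotient φ x) (N : ModuleCat.{v} R) (n : ℕ) :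
    Function.Bijective (h.twistHom N n) := by
  -- Twisting along an automorphism is exact, fully faithful and preserves projectives.
  have hF : Function.Bijective (h.twist.mapExtAddHom N (ModuleCat.of R R) n) :=
    h.twist.mapExt_bijective_of_preservesProjectiveObjects _ _ _
  refine Function.Bijective.comp (g := fun ξ : Ext (h.twist.obj N) _ n =>
    ξ.comp (Ext.mk₀ h.twistSelf) (add_zero n)) ?_ hF
  refine Function.bijective_iff_has_inverse.2
    ⟨fun ξ => ξ.comp (Ext.mk₀ (inv h.twistSelf)) (add_zero n), fun ξ => ?_, fun ξ => ?_⟩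
  · simp
  · simp

lemma twistHom_comp_rightMul (h : IsNormalQuotient φ x) (N : ModuleCat.{v} R) {n : ℕ}
    (ξ : Ext.{v} N (ModuleCat.of R R) n) (r : R) :
    h.twistHom N n (ξ.comp (Ext.mk₀ (rightMul r)) (add_zero n)) =
      (h.twistHom N n ξ).comp (Ext.mk₀ (rightMul (h.conj r))) (add_zero n) := by
  rw [twistHom_apply, twistHom_apply, Ext.mapExactFunctor_comp, Ext.mapExactFunctor_mk₀,
    Ext.comp_assoc_of_third_deg_zero, Ext.mk₀_comp_mk₀, map_rightMul_comp_twistSelf,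
    ← Ext.mk₀_comp_mk₀, Ext.comp_assoc_of_third_deg_zero]

/-- Precomposition with multiplication by `x` on `N` corresponds to the right action of `x`. -/
lemma twistToId_comp (h : IsNormalQuotient φ x) (N : ModuleCat.{v} R) {n : ℕ}
    (ξ : Ext.{v} N (ModuleCat.of R R) n) :
    (Ext.mk₀ (h.twistToId.app N)).comp ξ (zero_add n) =
      h.twistHom N n (ξ.comp (Ext.mk₀ (rightMul x)) (add_zero n)) := by
  refine (ext_naturality_of_natTrans h.twist h.twistToId ξ).trans ?_
  -- Conjugation by `x` fixes `x`, so both sides carry right multiplication by the same element.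
  rw [twistHom_comp_rightMul, conj_self, twistToId_app_self, ← Ext.mk₀_comp_mk₀,
    ← Ext.comp_assoc_of_third_deg_zero, twistHom_apply]

section TwistShortComplex

variable {N M : ModuleCat.{v} R}

/-- The short complex `N → N → M` whose first map is multiplication by `x`. -/
def twistShortComplex (h : IsNormalQuotient φ x) (p : N ⟶ M) (hp : ∀ n : N, p (x • n) = 0) :
    ShortComplex (ModuleCat.{v} R) where
  X₁ := h.twist.obj N
  X₂ := N
  X₃ := M
  f := h.twistToId.app N
  g := p
  zero := ModuleCat.hom_ext (LinearMap.ext hp)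

lemma twistShortExact (h : IsNormalQuotient φ x) (p : N ⟶ M) (hp : ∀ n : N, p (x • n) = 0)
    (hsurj : Function.Surjective p) (hinj : ∀ n : N, x • n = 0 → n = 0)
    (hker : ∀ n : N, p n = 0 → ∃ n', x • n' = n) : (h.twistShortComplex p hp).ShortExact := by
  refine ModuleCat.shortComplex_shortExact _ (fun n => ⟨fun hn => hker n hn, ?_⟩)
    ((injective_iff_map_eq_zero _).2 hinj) hsurj
  rintro ⟨n, rfl⟩
  exact hp n

variable {h : IsNormalQuotient φ x} {p : N ⟶ M} {hp : ∀ n : N, p (x • n) = 0}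
  (hT : (h.twistShortComplex p hp).ShortExact)

/-- The connecting homomorphism `Ext^n(N, R) → Ext^{n+1}(M, R)` for the quotient `M = N / x N`. -/
def twistδ (n : ℕ) : Ext.{v} N (ModuleCat.of R R) n →+ Ext.{v} M (ModuleCat.of R R) (n + 1) :=
  (hT.extClass.precomp (ModuleCat.of R R) (add_comm 1 n)).comp (h.twistHom N n)

lemma twistδ_apply (n : ℕ) (ξ : Ext.{v} N (ModuleCat.of R R) n) :
    twistδ hT n ξ = hT.extClass.comp (h.twistHom N n ξ) (add_comm 1 n) := rfl

lemma twistδ_comp_rightMul (n : ℕ) (ξ : Ext.{v} N (ModuleCat.of R R) n) (r : R) :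
    twistδ hT n (ξ.comp (Ext.mk₀ (rightMul r)) (add_zero n)) =
      (twistδ hT n ξ).comp (Ext.mk₀ (rightMul (h.conj r))) (add_zero (n + 1)) := by
  rw [twistδ_apply, twistδ_apply, twistHom_comp_rightMul]
  exact (Ext.comp_assoc_of_third_deg_zero _ _ _ _).symm

lemma twistδ_surjective (n : ℕ) (hN : Subsingleton (Ext.{v} N (ModuleCat.of R R) (n + 1))) :
    Function.Surjective (twistδ hT n) := by
  intro y
  obtain ⟨z, hz⟩ := Ext.contravariant_sequence_exact₃ hT (ModuleCat.of R R) y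
    (hN.elim _ _) (add_comm 1 n)
  obtain ⟨ξ, rfl⟩ := (h.twistHom_bijective N n).2 z
  exact ⟨ξ, hz⟩

/-- By `twistToId_comp`, the map preceding the connecting one is right multiplication by `x` up to
`twistHom`. -/
lemma twistδ_eq_zero_iff (n : ℕ) (ξ : Ext.{v} N (ModuleCat.of R R) n) :
    twistδ hT n ξ = 0 ↔ ∃ η : Ext.{v} N (ModuleCat.of R R) n,
      η.comp (Ext.mk₀ (rightMul x)) (add_zero n) = ξ := by
  constructor
  · intro hξ
    obtain ⟨η, hη⟩ := Ext.contravariant_sequence_exact₁ hT (ModuleCat.of R R)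
      (h.twistHom N n ξ) (add_comm 1 n) hξ
    exact ⟨η, (h.twistHom_bijective N n).1 ((h.twistToId_comp N η).symm.trans hη)⟩
  · rintro ⟨η, rfl⟩
    rw [twistδ_apply, ← h.twistToId_comp]
    exact hT.extClass_comp_assoc η

/-- `Ext^{n+1}(M, R)` sits between `Ext^n` of the twist of `N` and the kernel of `x` on
`Ext^{n+1}(N, R)`; both vanish. -/
lemma ext_subsingleton_of_twist {h : IsNormalQuotient φ x} {p : N ⟶ M}
    {hp : ∀ n : N, p (x • n) = 0} (hT : (h.twistShortComplex p hp).ShortExact) (n : ℕ)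
    (hinj : ∀ η : Ext.{v} N (ModuleCat.of R R) (n + 1),
      η.comp (Ext.mk₀ (rightMul x)) (add_zero (n + 1)) = 0 → η = 0)
    (hN : Subsingleton (Ext.{v} N (ModuleCat.of R R) n)) :
    Subsingleton (Ext.{v} M (ModuleCat.of R R) (n + 1)) := by
  refine subsingleton_of_forall_eq 0 fun y => ?_
  have hy : (Ext.mk₀ p).comp y (zero_add (n + 1)) = 0 := by
    apply hinj
    apply (h.twistHom_bijective N (n + 1)).1
    rw [map_zero, ← h.twistToId_comp, Ext.mk₀_comp_mk₀_assoc]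
    have h0 : h.twistToId.app N ≫ p = 0 := (h.twistShortComplex p hp).zero
    refine (congrArg (fun f => (Ext.mk₀ f).comp y (zero_add (n + 1))) h0).trans ?_
    rw [Ext.mk₀_zero, Ext.zero_comp]
  obtain ⟨z, hz⟩ := Ext.contravariant_sequence_exact₃ hT (ModuleCat.of R R) y hy (add_comm 1 n)
  obtain ⟨ξ, rfl⟩ := (h.twistHom_bijective N n).2 z
  rw [← hz, hN.elim ξ 0, map_zero]
  exact Ext.comp_zero _ _ _ _ _

end TwistShortComplex

end IsNormalQuotient

/-! ### Recognition of twisted bimodules. -/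

section TwistedBimodule

variable {K : Type u} [Field K] {B : Type v} [Ring B] [Algebra K B]

/-- A bimodule over a `K`-algebra on which `K` acts centrally and which is free of rank one as a
left module is isomorphic to a twisted bimodule. -/
lemma exists_bimoduleIso_twistedBimodule {M : Type*} [AddCommGroup M] [Module B M] [Module Bᵐᵒᵖ M]
    [SMulCommClass B Bᵐᵒᵖ M]
    (hK : ∀ (k : K) (m : M), op (algebraMap K B k) • m = algebraMap K B k • m) (m₀ : M)
    (hm₀ : Function.Bijective fun b : B => b • m₀) :
    ∃ κ : B →ₐ[K] B, BimoduleIso B M (TwistedBimodule κ) := by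
  -- `κ b` is the unique coefficient with `κ(b) m₀ = m₀ b`; uniqueness makes `κ` a ring
  -- homomorphism, and centrality of `K` makes it `K`-linear.
  choose κ hκ using fun b : B => hm₀.2 (op b • m₀)
  dsimp only at hκ
  let κ' : B →ₐ[K] B :=
    { toFun := κ
      map_one' := hm₀.1 (by dsimp only; rw [hκ, op_one, one_smul, one_smul])
      map_mul' b c := hm₀.1 (by
        dsimp only
        rw [hκ, op_mul, mul_smul, ← hκ b, ← smul_comm, ← hκ c, mul_smul])
      map_zero' := hm₀.1 (by dsimp only; rw [hκ, op_zero, zero_smul, zero_smul])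
      map_add' b c := hm₀.1 (by dsimp only; rw [hκ, MulOpposite.op_add, add_smul, add_smul, hκ, hκ])
      commutes' k := hm₀.1 (by dsimp only; rw [hκ, hK]) }
  let f : B →+ M := (smulAddHom B M).flip m₀
  let e : TwistedBimodule κ' ≃+ M := AddEquiv.ofBijective (M := TwistedBimodule κ') f hm₀
  refine ⟨κ', e.symm, fun a m => ?_, fun b m => ?_⟩
  · obtain ⟨c, rfl⟩ := e.surjective m
    rw [AddEquiv.symm_apply_apply, AddEquiv.symm_apply_eq]
    exact (mul_smul a (show B from c) m₀).symm
  · obtain ⟨c, rfl⟩ := e.surjective m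
    rw [AddEquiv.symm_apply_apply, AddEquiv.symm_apply_eq]
    change op b • (show B from c) • m₀ = ((show B from c) * κ b) • m₀
    rw [mul_smul, hκ]
    exact (smul_comm _ _ _).symm

end TwistedBimodule

/-! ### From `A^e` to `B^e`: the two changes of rings and the connecting map. -/

section EnvelopingQuotient

open Abelian

variable {K : Type u} [Field K] {A B : Type v} [Ring A] [Algebra K A] [Ring B] [Algebra K B]

variable (π : A →ₐ[K] B)

/-- The homomorphism `A ⊗ Aᵒᵖ → B ⊗ Aᵒᵖ`. -/
abbrev envMapLeft : EnvelopingAlgebra K A →+* B ⊗[K] Aᵐᵒᵖ :=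
  (Algebra.TensorProduct.map π (AlgHom.id K Aᵐᵒᵖ)).toRingHom

/-- The homomorphism `C ⊗ Aᵒᵖ → C ⊗ Bᵒᵖ`. -/
abbrev envMapRight (C : Type v) [Ring C] [Algebra K C] : C ⊗[K] Aᵐᵒᵖ →+* C ⊗[K] Bᵐᵒᵖ :=
  (Algebra.TensorProduct.map (AlgHom.id K C) (AlgHom.op π)).toRingHom

/-- The `B`-bimodule `B` as a module over `A ⊗ Aᵒᵖ`. -/
abbrev quotientEnvModule : ModuleCat.{v} (EnvelopingAlgebra K A) :=
  (ModuleCat.restrictScalars (envMapLeft π)).obj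
    ((ModuleCat.restrictScalars (envMapRight π B)).obj (regularEnvModule K B))

/-- An algebra homomorphism `A → B`, as an additive map between bimodules. -/
def quotientEnvAddHom : regularEnvModule K A →+
    (ModuleCat.restrictScalars (envMapRight π B)).obj (regularEnvModule K B) where
  toFun a := π (show A from a)
  map_zero' := map_zero π
  map_add' a b := map_add π (show A from a) (show A from b)

lemma quotientEnvAddHom_smul (r : EnvelopingAlgebra K A) (m : regularEnvModule K A) :
    quotientEnvAddHom π (r • m) = envMapLeft π r • quotientEnvAddHom π m := by
  induction r using TensorProduct.induction_on with
  | zero =>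
    exact (congrArg _ (zero_smul (EnvelopingAlgebra K A) m)).trans <| (map_zero _).trans <|
      (zero_smul (B ⊗[K] Aᵐᵒᵖ) (show (ModuleCat.restrictScalars (envMapRight π B)).obj
        (regularEnvModule K B) from quotientEnvAddHom π m)).symm.trans <|
        congrArg (· • quotientEnvAddHom π m) (map_zero (envMapLeft π)).symm
  | add r s hr hs => rw [add_smul, map_add, hr, hs, map_add, add_smul]
  | tmul a b =>
    have e₁ := regularEnvModule_smul (K := K) a (show A from m) b
    have e₂ := regularEnvModule_smul (K := K) (π a) (π (show A from m)) (op (π b.unop))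
    refine (congrArg π e₁).trans (Eq.trans ?_ e₂.symm)
    rw [map_mul, map_mul, unop_op]

/-- An algebra homomorphism `A → B` as a morphism of `A`-bimodules. -/
def quotientEnvHom : regularEnvModule K A ⟶ quotientEnvModule π :=
  toRestrictScalars (envMapLeft π) (quotientEnvAddHom π) (quotientEnvAddHom_smul π)

variable {π} {ω : A}

namespace IsNormalQuotient

lemma envLeft (h : IsNormalQuotient (π : A →+* B) ω) :
    IsNormalQuotient (envMapLeft π) (ω ⊗ₜ[K] (1 : Aᵐᵒᵖ)) := h.map_id Aᵐᵒᵖ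

lemma envRight (h : IsNormalQuotient (π : A →+* B) ω) (C : Type v) [Ring C] [Algebra K C] :
    IsNormalQuotient (envMapRight π C) ((1 : C) ⊗ₜ[K] op ω) :=
  IsNormalQuotient.id_map (φ := AlgHom.op π) C h.op

lemma quotientEnvHom_smul (h : IsNormalQuotient (π : A →+* B) ω) (n : regularEnvModule K A) :
    quotientEnvHom π (((1 : A) ⊗ₜ[K] op ω : EnvelopingAlgebra K A) • n) = 0 := by
  have e := regularEnvModule_smul (K := K) (1 : A) (show A from n) (op ω)
  refine (congrArg π e).trans ?_
  have hω : π ω = 0 := h.map_eq_zero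
  rw [unop_op, map_mul, hω, mul_zero]
  rfl

lemma env_twistShortExact (h : IsNormalQuotient (π : A →+* B) ω) :
    ((h.envRight A).twistShortComplex (quotientEnvHom π) h.quotientEnvHom_smul).ShortExact := by
  have e (n : A) : ((1 : A) ⊗ₜ[K] op ω : EnvelopingAlgebra K A) •
      (show regularEnvModule K A from n) = n * ω :=
    (regularEnvModule_smul (K := K) (1 : A) n (op ω)).trans (by rw [one_mul, unop_op])
  refine (h.envRight A).twistShortExact _ _ h.surjective (fun n hn => ?_) fun n hn => ?_
  · exact h.regular.right ((e n).symm.trans (hn.trans (zero_mul ω).symm))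
  · obtain ⟨s, hs⟩ := h.exists_mul_left (r := (show A from n)) hn
    exact ⟨s, (e s).trans hs⟩

/-- Conjugation by `1 ⊗ ω` over `A ⊗ Aᵒᵖ` and over `B ⊗ Aᵒᵖ` agree on `1 ⊗ Aᵒᵖ`. -/
lemma exists_conj_eq (h : IsNormalQuotient (π : A →+* B) ω) (a : A) :
    ∃ a' : A, ∀ (C : Type v) [Ring C] [Algebra K C],
      (h.envRight C).conj ((1 : C) ⊗ₜ[K] op a) = (1 : C) ⊗ₜ[K] op a' := by
  obtain ⟨a', ha'⟩ := h.exists_eq_mul a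
  refine ⟨a', fun C _ _ => (h.envRight C).conj_eq ?_⟩
  rw [Algebra.TensorProduct.tmul_mul_tmul, Algebra.TensorProduct.tmul_mul_tmul, ← op_mul,
    ← op_mul, ha']

/-- `ω ⊗ 1` commutes with `1 ⊗ a`, so this change of rings does not twist the left action. -/
lemma envLeft_conj (h : IsNormalQuotient (π : A →+* B) ω) (a : A) :
    h.envLeft.conj ((1 : A) ⊗ₜ[K] op a) = (1 : A) ⊗ₜ[K] op a :=
  h.envLeft.conj_eq (by simp)

/-- The double change of rings isomorphism. -/
def reesEnvEquiv (h : IsNormalQuotient (π : A →+* B) ω) (l : ℕ) :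
    EnvExt K B l ≃+ Ext.{v} (quotientEnvModule π) (envSelfModule K A) (l + 2) :=
  ((EnvExt.toExt K B l).trans
    (AddEquiv.ofBijective _ ((h.envRight B).reesHom_bijective (regularEnvModule K B) l))).trans
    (AddEquiv.ofBijective _ (h.envLeft.reesHom_bijective
      ((ModuleCat.restrictScalars (envMapRight π B)).obj (regularEnvModule K B)) (l + 1)))

lemma reesEnvEquiv_apply (h : IsNormalQuotient (π : A →+* B) ω) {l : ℕ} (ξ : EnvExt K B l) :
    h.reesEnvEquiv l ξ =
      h.envLeft.reesHom _ (l + 1) ((h.envRight B).reesHom _ l (EnvExt.toExt K B l ξ)) := rfl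

lemma reesEnvEquiv_smul (h : IsNormalQuotient (π : A →+* B) ω) {l : ℕ} (a : A)
    (ξ : EnvExt K B l) :
    h.reesEnvEquiv l (π a • ξ) =
      (h.reesEnvEquiv l ξ).comp
        (Ext.mk₀ (rightMul ((h.envRight A).conj ((1 : A) ⊗ₜ[K] op a)))) (add_zero (l + 2)) := by
  obtain ⟨a', ha'⟩ := h.exists_conj_eq a
  have e₁ : EnvExt.toExt K B l (π a • ξ) = (EnvExt.toExt K B l ξ).comp
      (Ext.mk₀ (rightMul (envMapRight π B ((1 : B) ⊗ₜ[K] op a)))) (add_zero l) := rfl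
  have e₂ : ((1 : B) ⊗ₜ[K] op a' : B ⊗[K] Aᵐᵒᵖ) = envMapLeft π ((1 : A) ⊗ₜ[K] op a') := by
    simp
  rw [reesEnvEquiv_apply, reesEnvEquiv_apply, e₁, reesHom_comp_rightMul, ha' B, e₂,
    reesHom_comp_rightMul, h.envLeft_conj, ha' A]

/-- The connecting homomorphism `Ext^n(A, Aᵉ) → Ext^{n-1}(B, Bᵉ)`. -/
def envδ (h : IsNormalQuotient (π : A →+* B) ω) (l : ℕ) : EnvExt K A (l + 1) →+ EnvExt K B l :=
  (h.reesEnvEquiv l).symm.toAddMonoidHom.comp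
    ((twistδ h.env_twistShortExact (l + 1)).comp (EnvExt.toExt K A (l + 1)).toAddMonoidHom)

lemma reesEnvEquiv_envδ (h : IsNormalQuotient (π : A →+* B) ω) {l : ℕ}
    (ξ : EnvExt K A (l + 1)) :
    h.reesEnvEquiv l (h.envδ l ξ) =
      twistδ h.env_twistShortExact (l + 1) (EnvExt.toExt K A (l + 1) ξ) :=
  (h.reesEnvEquiv l).apply_symm_apply _

/-- The change of rings and the connecting map both twist `1 ⊗ a` by conjugation with `1 ⊗ ω`, so
the twists cancel. -/
lemma envδ_smul (h : IsNormalQuotient (π : A →+* B) ω) {l : ℕ} (a : A)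
    (ξ : EnvExt K A (l + 1)) : h.envδ l (a • ξ) = π a • h.envδ l ξ := by
  apply (h.reesEnvEquiv l).injective
  rw [reesEnvEquiv_smul, reesEnvEquiv_envδ, reesEnvEquiv_envδ]
  exact twistδ_comp_rightMul h.env_twistShortExact (l + 1) _ _

lemma envδ_surjective (h : IsNormalQuotient (π : A →+* B) ω) {l : ℕ}
    (hA : Subsingleton (EnvExt K A (l + 2))) : Function.Surjective (h.envδ l) :=
  (h.reesEnvEquiv l).symm.surjective.comp
    ((twistδ_surjective h.env_twistShortExact (l + 1) hA).comp
      (EnvExt.toExt K A (l + 1)).surjective)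

lemma envδ_eq_zero_iff (h : IsNormalQuotient (π : A →+* B) ω) {l : ℕ}
    (ξ : EnvExt K A (l + 1)) : h.envδ l ξ = 0 ↔ ∃ η : EnvExt K A (l + 1), ω • η = ξ := by
  rw [← (h.reesEnvEquiv l).map_eq_zero_iff, reesEnvEquiv_envδ]
  exact twistδ_eq_zero_iff h.env_twistShortExact (l + 1) _

lemma envExt_subsingleton (h : IsNormalQuotient (π : A →+* B) ω) {l : ℕ}
    (hinj : ∀ η : EnvExt K A (l + 2), ω • η = 0 → η = 0)
    (hA : Subsingleton (EnvExt K A (l + 1))) : Subsingleton (EnvExt K B l) :=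
  have := ext_subsingleton_of_twist h.env_twistShortExact (l + 1) hinj hA
  (h.reesEnvEquiv l).injective.subsingleton

end IsNormalQuotient

/-- Scalars pass through the tensor: `k ⊗ 1 = 1 ⊗ k`. -/
lemma EnvExt.algebraMap_op_smul {l : ℕ} (k : K) (ξ : EnvExt K A l) :
    op (algebraMap K A k) • ξ = algebraMap K A k • ξ := by
  rw [EnvExt.smul_op_def, EnvExt.smul_def]
  congr 1
  rw [Algebra.algebraMap_eq_smul_one, op_smul, op_one, TensorProduct.smul_tmul]

end EnvelopingQuotient

/-! ### The main theorem. -/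

theorem lemma3p9 {K : Type u} [Field K] [CharZero K] {A : Type v} [Ring A] [Algebra K A]
    (ω : A) (hreg : IsRegular ω) (hnorm : IsNormalElement ω) (d : ℕ) (ν : A →ₐ[K] A)
    (hvanish : ∀ l : ℕ, l ≠ d + 1 → Subsingleton (EnvExt K A l))
    (htop : BimoduleIso A (EnvExt K A (d + 1)) (TwistedBimodule ν)) :
    ∃ κ : hnorm.Quotient →ₐ[K] hnorm.Quotient,
      (∀ l : ℕ, l ≠ d → Subsingleton (EnvExt K hnorm.Quotient l)) ∧
      BimoduleIso hnorm.Quotient (EnvExt K hnorm.Quotient d) (TwistedBimodule κ) := by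
  have h : IsNormalQuotient ((Ideal.Quotient.mkₐ K hnorm.ideal : A →ₐ[K] hnorm.Quotient) :
      A →+* hnorm.Quotient) ω := hnorm.isNormalQuotient hreg
  obtain ⟨e, he, -⟩ := htop
  have hinj (η : EnvExt K A (d + 1)) (hη : ω • η = 0) : η = 0 := by
    apply e.injective
    rw [map_zero]
    refine hreg.left ?_
    change ω * (show A from e η) = ω * 0
    rw [mul_zero]
    exact (he ω η).symm.trans ((congrArg e hη).trans (map_zero e))
  -- The free left generator corresponding to `1 ∈ A^ν`; its image under `envδ` will generate the
  -- Ext group of `B`.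
  let ε : EnvExt K A (d + 1) := e.symm (show TwistedBimodule ν from (1 : A))
  have hε (ξ : EnvExt K A (d + 1)) : (show A from e ξ) • ε = ξ := by
    apply e.injective
    rw [he, AddEquiv.apply_symm_apply]
    exact mul_one (show A from e ξ)
  have hε' (a : A) : (show A from e (a • ε)) = a := by
    rw [he, AddEquiv.apply_symm_apply]
    exact mul_one a
  -- `envδ` is onto with kernel `ω Ext^{d+1}`, so `a ↦ envδ (a ε)` induces a bijection from `A / ω
  -- A`.
  have hbij : Function.Bijective fun b : hnorm.Quotient => b • h.envδ d ε := by
    constructor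
    · refine (injective_iff_map_eq_zero
        ((smulAddHom hnorm.Quotient (EnvExt K hnorm.Quotient d)).flip (h.envδ d ε))).2 fun b hb => ?_
      obtain ⟨a, rfl⟩ := h.surjective b
      have hb' : h.envδ d (a • ε) = 0 := (h.envδ_smul a ε).trans hb
      obtain ⟨η, hη⟩ := (h.envδ_eq_zero_iff _).1 hb'
      have ha : a = ω * (show A from e η) := by
        rw [← hε' a, ← hη, he]
        rfl
      rw [ha, map_mul, h.map_eq_zero, zero_mul]
    · intro ξ
      obtain ⟨η, rfl⟩ := h.envδ_surjective (hvanish (d + 2) (by lia)) ξ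
      exact ⟨Ideal.Quotient.mkₐ K hnorm.ideal (show A from e η),
        (h.envδ_smul _ ε).symm.trans (congrArg (h.envδ d) (hε η))⟩
  obtain ⟨κ, hκ⟩ := exists_bimoduleIso_twistedBimodule (K := K)
    (fun k ξ => EnvExt.algebraMap_op_smul k ξ) (h.envδ d ε) hbij
  refine ⟨κ, fun l hl => h.envExt_subsingleton (fun η hη => ?_) (hvanish (l + 1) (by lia)), hκ⟩
  -- In degree `l = d - 1` the group `Ext^{l+2}(A, A^e)` is the nonzero one, and injectivity of `ω`
  -- is what is needed.
  by_cases hd : l + 2 = d + 1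
  · obtain rfl : d = l + 1 := by lia
    exact hinj η hη
  · have := hvanish (l + 2) hd
    exact Subsingleton.elim _ _

end
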